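/- **Theorem.** There is an absolute constant $C$ with the following property. Let $G$ be a finite simple graph on $n$ vertices. An *odd matching* of $G$ is a set of pairwise disjoint edges of $G$ such that exactly one vertex of $G$, the isolated vertex, is not covered. A *flip* removes one edge from an odd matching $M$ and replaces it with another edge of $G$ that is incident to the isolated vertex of $M$, such that the result is again an odd matching. The *flip graph* of $G$ has the odd matchings of $G$ as its vertices, two of them being adjacent if they differ in a single flip; $M$ can be *reconfigured* to $M'$ if there is a path between them in the flip graph. 1. If $M$ and $M'$ are odd matchings of $G$ such that $M$ can be reconfigured to $M'$, then $M$ can be reconfigured to $M'$ by a sequence of at most $Cn$ flips. 2. Consequently, every connected component of the flip graph of $G$ has diameter at most $Cn$. -/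

import Mathlib

namespace OddMatchings

/-- An odd matching of `G`: a matching that leaves exactly one vertex of `G` uncovered.
(For a matching in Mathlib's sense, the vertex set of the subgraph is exactly the set of
endpoints of its edges, so such a subgraph is the same as its set of edges.) -/
def IsOddMatching {V : Type*} {G : SimpleGraph V} (M : G.Subgraph) : Prop :=
  M.IsMatching ∧ ∃! v, v ∉ M.verts

/-- The type of odd matchings of `G`. -/
abbrev OddMatching {V : Type*} (G : SimpleGraph V) : Type _ :=
  {M : G.Subgraph // IsOddMatching M}

/-- `M'` arises from `M` by a (combinatorial) flip: an edge `e` of `M` is removed and replaced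
by another edge `f` of `G`, which is incident to the vertex not covered by `M`. That the result
is an odd matching again is part of the type of `M'`. -/
def IsFlip {V : Type*} {G : SimpleGraph V} (M M' : OddMatching G) : Prop :=
  ∃ e ∈ M.1.edgeSet, ∃ f ∈ G.edgeSet, f ∉ M.1.edgeSet ∧
    (∃ v, v ∉ M.1.verts ∧ v ∈ f) ∧
    M'.1.edgeSet = insert f (M.1.edgeSet \ {e})

theorem IsFlip.symm {V : Type*} {G : SimpleGraph V} {M M' : OddMatching G}
    (h : IsFlip M M') : IsFlip M' M := by
  obtain ⟨e, he, f, hf, hfM, ⟨v, hv, hvf⟩, hM'⟩ := h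
  obtain ⟨w, rfl⟩ := Sym2.mem_iff_exists.mp hvf
  have hvw : v ≠ w := G.ne_of_adj hf
  have hw : w ∈ M.1.verts := by
    by_contra hw
    exact hvw (M.2.2.unique hv hw)
  obtain ⟨x, hwx, -⟩ := M.2.1 hw
  have hxv : x ≠ v := fun h => hv (h ▸ M.1.edge_vert hwx.symm)
  have hxw : x ≠ w := (M.1.adj_sub hwx).ne'
  have hM'adj : ∀ a b, M'.1.Adj a b ↔ s(a, b) = s(v, w) ∨ (M.1.Adj a b ∧ s(a, b) ≠ e) := by
    intro a b
    rw [← SimpleGraph.Subgraph.mem_edgeSet, hM']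
    simp
  have hnew : M'.1.Adj v w := (hM'adj v w).2 (Or.inl rfl)
  have hex : s(w, x) = e := by
    by_contra hne
    have h1 : M'.1.Adj w x := (hM'adj w x).2 (Or.inr ⟨hwx, hne⟩)
    exact hxv ((M'.2.1 (M'.1.edge_vert h1)).unique h1 hnew.symm)
  subst hex
  refine ⟨s(v, w), hnew, s(w, x), hwx.adj_sub, ?_, ⟨x, ?_, by simp⟩, ?_⟩
  · intro h1
    exact hxv ((M'.2.1 (M'.1.edge_vert h1)).unique h1 hnew.symm)
  · intro hx
    obtain ⟨y, hxy, -⟩ := M'.2.1 hx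
    rcases (hM'adj x y).1 hxy with h1 | ⟨h1, h2⟩
    · rcases Sym2.eq_iff.mp h1 with ⟨h, -⟩ | ⟨h, -⟩
      · exact hxv h
      · exact hxw h
    · have : y = w := (M.2.1 (M.1.edge_vert h1)).unique h1 hwx.symm
      subst this
      exact h2 Sym2.eq_swap
  · rw [hM']
    ext g
    simp only [Set.mem_insert_iff, Set.mem_sdiff, Set.mem_singleton_iff]
    by_cases h1 : g = s(w, x)
    · subst h1; simpa using hwx
    · by_cases h2 : g = s(v, w)
      · subst h2; simp [h1]; exact hfM
      · simp [h1, h2]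

/-- The (combinatorial) flip graph of `G`: its vertices are the odd matchings of `G`, two of
them being adjacent if they differ by a single flip. -/
def flipGraph {V : Type*} (G : SimpleGraph V) : SimpleGraph (OddMatching G) where
  Adj M M' := IsFlip M M'
  symm := ⟨fun _ _ h => h.symm⟩
  loopless := ⟨fun M h => by
    obtain ⟨e, -, f, -, hfM, -, hM⟩ := h
    exact hfM (hM ▸ Set.mem_insert f _)⟩

/-- `M` can be reconfigured to `M'` using at most `k` flips. -/
def ReconfigurableWithin {V : Type*} {G : SimpleGraph V} (k : ℕ) (M M' : OddMatching G) : Prop :=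
  ∃ p : (flipGraph G).Walk M M', p.length ≤ k

/-- `M` can be reconfigured to `M'`: there is a path between them in the flip graph. -/
def Reconfigurable {V : Type*} {G : SimpleGraph V} (M M' : OddMatching G) : Prop :=
  (flipGraph G).Reachable M M'

end OddMatchings

/-! An odd matching is an involution `partner` with exactly one fixed point, the hole, and a flip
slides the hole along an edge of `G` to a vertex `w` and on to the old partner of `w`.

The first ingredient is a tour: a closed flip sequence of length at most `2n` from `M` to itself
that brings the hole to every position it has in any odd matching (`exists_tour`). It grows like an
ear decomposition. An `M`-alternating ear with `2k` new vertices is run through once from each end,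
and each run out and back costs `2k` flips, so every vertex is charged two flips.

The second is an exchange (`exists_walk_exchange`). Let `M` and `M'` have the same hole. Apart from
that hole, the components of their union are single common edges or alternating cycles. When the
tour disturbs a component for the last time and restores it, the hole stands next to it and can
rotate it from `M` to `M'` at a cost of at most twice its size (`exists_walk_rotate`). As the rest
of the tour leaves that component alone, it can be carried out unchanged. All rotations together
cost at most `2n`.

If `M` can be reconfigured to `M'`, the hole enters every component on which they differ, so the
tour disturbs all of these and the modified tour ends in `M'` after at most `4n` flips. Bringing the
hole of `M` to the hole of `M'` beforehand costs at most `n` more. -/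

namespace OddMatchings

variable {V : Type*} {G : SimpleGraph V}

/-! ### Odd matchings as involutions with one fixed point -/

/-- The vertex left uncovered by an odd matching. -/
noncomputable def hole (M : OddMatching G) : V := M.2.2.choose

open Classical in
/-- The vertex matched to `v`; the uncovered vertex is its own partner. -/
noncomputable def partner (M : OddMatching G) (v : V) : V :=
  if h : v ∈ M.1.verts then (M.2.1 h).choose else v

theorem notMem_verts_iff (M : OddMatching G) (v : V) : v ∉ M.1.verts ↔ v = hole M :=
  ⟨fun h => M.2.2.choose_spec.2 v h, fun h => h ▸ M.2.2.choose_spec.1⟩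

theorem mem_verts_iff (M : OddMatching G) (v : V) : v ∈ M.1.verts ↔ v ≠ hole M := by
  rw [← not_iff_not, notMem_verts_iff, not_not]

theorem adj_iff (M : OddMatching G) (v w : V) : M.1.Adj v w ↔ v ≠ hole M ∧ partner M v = w := by
  by_cases h : v ∈ M.1.verts
  · have h1 := (M.2.1 h).choose_spec
    rw [partner, dif_pos h, ← mem_verts_iff]
    exact ⟨fun h2 => ⟨h, (h1.2 w h2).symm⟩, fun h2 => h2.2 ▸ h1.1⟩
  · refine ⟨fun h2 => absurd (M.1.edge_vert h2) h, fun h2 => ?_⟩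
    exact absurd ((mem_verts_iff M v).2 h2.1) h

theorem partner_hole (M : OddMatching G) : partner M (hole M) = hole M :=
  dif_neg ((notMem_verts_iff M _).2 rfl)

theorem adj_partner (M : OddMatching G) {v : V} (h : v ≠ hole M) : G.Adj v (partner M v) :=
  ((adj_iff M v _).2 ⟨h, rfl⟩).adj_sub

theorem partner_eq_self {M : OddMatching G} {v : V} : partner M v = v ↔ v = hole M := by
  refine ⟨fun h => ?_, fun h => h ▸ partner_hole M⟩
  by_contra h1
  exact (adj_partner M h1).ne h.symm

theorem partner_partner (M : OddMatching G) (v : V) : partner M (partner M v) = v := by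
  by_cases h : v = hole M
  · rw [h, partner_hole, partner_hole]
  · exact ((adj_iff M _ _).1 ((adj_iff M v _).2 ⟨h, rfl⟩).symm).2

theorem partner_injective (M : OddMatching G) : Function.Injective (partner M) :=
  Function.LeftInverse.injective (partner_partner M)

theorem partner_eq_comm {M : OddMatching G} {v w : V} : partner M v = w ↔ partner M w = v :=
  ⟨fun h => h ▸ partner_partner M v, fun h => h ▸ partner_partner M w⟩

theorem ext_partner {M N : OddMatching G} (h : ∀ v, partner M v = partner N v) : M = N := by
  have hh : hole M = hole N := partner_eq_self.1 (by rw [← h, partner_hole])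
  apply Subtype.ext
  apply SimpleGraph.Subgraph.ext
  · ext v
    rw [mem_verts_iff, mem_verts_iff, hh]
  · ext v w
    rw [adj_iff, adj_iff, hh, h]

theorem hole_eq_of_partner {M : OddMatching G} {v : V} (h : partner M v = v) : hole M = v :=
  (partner_eq_self.1 h).symm

theorem exists_of_partner (f : V → V) (u : V) (hinv : ∀ v, f (f v) = v) (hu : f u = u)
    (hadj : ∀ v, v ≠ u → G.Adj v (f v)) : ∃ M : OddMatching G, ∀ v, partner M v = f v := by
  have hne : ∀ v, v ≠ u → f v ≠ u := fun v hv h => hv (by rw [← hinv v, h, hu])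
  let S : G.Subgraph :=
    { verts := {v | v ≠ u}
      Adj := fun v w => v ≠ u ∧ f v = w
      adj_sub := by
        rintro v w ⟨hv, rfl⟩
        exact hadj v hv
      edge_vert := fun h => h.1
      symm := ⟨by
        rintro v w ⟨hv, rfl⟩
        exact ⟨hne v hv, hinv v⟩⟩ }
  have hS : IsOddMatching S := by
    refine ⟨fun v hv => ⟨f v, ⟨hv, rfl⟩, fun w hw => hw.2.symm⟩, u, by simp [S], ?_⟩
    intro v hv
    simpa [S] using hv
  refine ⟨⟨S, hS⟩, fun v => ?_⟩
  by_cases hv : v = u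
  · subst hv
    have : v = hole ⟨S, hS⟩ := (notMem_verts_iff ⟨S, hS⟩ v).1 (by simp [S])
    rw [hu, partner_eq_self]
    exact this
  · exact ((adj_iff ⟨S, hS⟩ v (f v)).1 ⟨hv, rfl⟩).2

/-! ### Flips as slides of the hole -/

/-- `N` arises from `M` by matching the hole of `M` to `w`, which makes the old partner of `w`
the new hole. -/
structure Slide (M N : OddMatching G) (w : V) : Prop where
  adj : G.Adj (hole M) w
  hole_eq : hole N = partner M w
  old_hole : partner N (hole M) = w
  partner_of_ne : ∀ v, v ≠ hole M → v ≠ w → v ≠ partner M w → partner N v = partner M v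

namespace Slide

variable {M N : OddMatching G} {w : V}

theorem middle (h : Slide M N w) : partner N w = hole M := partner_eq_comm.1 h.old_hole

theorem ne_hole (h : Slide M N w) : w ≠ hole M := h.adj.ne'

theorem partner_ne_hole (h : Slide M N w) : partner M w ≠ hole M := fun h1 =>
  h.ne_hole (by rw [← partner_partner M w, h1, partner_hole])

theorem partner_ne (h : Slide M N w) : partner M w ≠ w := fun h1 =>
  h.ne_hole (partner_eq_self.1 h1)

theorem new_hole (h : Slide M N w) : partner N (partner M w) = partner M w := by
  rw [← h.hole_eq, partner_hole]

theorem flipGraph_adj (h : Slide M N w) : (flipGraph G).Adj M N := by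
  refine ⟨s(w, partner M w), (adj_iff _ _ _).2 ⟨h.ne_hole, rfl⟩, s(hole M, w), h.adj, ?_,
    ⟨hole M, (notMem_verts_iff _ _).2 rfl, by simp⟩, ?_⟩
  · intro h1
    exact ((adj_iff _ _ _).1 h1).1 rfl
  · ext e
    induction e using Sym2.ind with
    | _ a b =>
      have h1 := h.middle
      have h2 := h.old_hole
      have h3 := h.new_hole
      have h4 := h.ne_hole
      have h5 := h.partner_ne_hole
      have h6 := h.partner_ne
      have h7 := partner_partner M w
      have h8 := partner_hole M
      simp only [Set.mem_insert_iff, Set.mem_sdiff, Set.mem_singleton_iff,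
        SimpleGraph.Subgraph.mem_edgeSet, adj_iff, Sym2.eq_iff, h.hole_eq]
      by_cases ha : a = hole M
      · grind
      by_cases ha2 : a = w
      · grind
      by_cases ha3 : a = partner M w
      · grind
      rw [h.partner_of_ne a ha ha2 ha3]
      grind

end Slide

theorem exists_slide (M : OddMatching G) {w : V} (h : G.Adj (hole M) w) :
    ∃ N, Slide M N w := by
  classical
  -- The slide exchanges the roles of the hole and of the partner of `w`, so the new involution is
  -- the old one conjugated by this transposition.
  let τ := Equiv.swap (hole M) (partner M w)
  have hw : w ≠ hole M := h.ne'
  have hpw : partner M w ≠ hole M := fun h1 =>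
    hw (by rw [← partner_partner M w, h1, partner_hole])
  have hpw' : partner M w ≠ w := fun h1 => hw (partner_eq_self.1 h1)
  have hτw : τ w = w := Equiv.swap_apply_of_ne_of_ne hw hpw'.symm
  have e0 : τ (partner M (τ (hole M))) = w := by
    simp only [τ, Equiv.swap_apply_left, partner_partner]
    exact hτw
  have e1 : ∀ v, v ≠ hole M → v ≠ w → v ≠ partner M w → τ (partner M (τ v)) = partner M v := by
    intro v h1 h2 h3
    have h4 : τ v = v := Equiv.swap_apply_of_ne_of_ne h1 h3
    rw [h4]
    apply Equiv.swap_apply_of_ne_of_ne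
    · exact fun h5 => h1 (by rw [← partner_partner M v, h5, partner_hole])
    · exact fun h5 => h2 (partner_injective M h5)
  have e2 : τ (partner M (τ w)) = hole M := by
    rw [hτw]; exact Equiv.swap_apply_right _ _
  have e3 : τ (partner M (τ (partner M w))) = partner M w := by
    simp only [τ, Equiv.swap_apply_right, partner_hole, Equiv.swap_apply_left]
  obtain ⟨N, hN⟩ := exists_of_partner (G := G) (fun v => τ (partner M (τ v))) (partner M w)
    (fun v => by simp [τ, partner_partner]) e3 (by
      intro v hv
      by_cases h1 : v = hole M
      · subst h1; rw [e0]; exact h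
      by_cases h2 : v = w
      · subst h2; rw [e2]; exact h.symm
      · rw [e1 v h1 h2 hv]; exact adj_partner M h1)
  exact ⟨N, h, hole_eq_of_partner (by rw [hN, e3]), by rw [hN, e0], fun v h1 h2 h3 => by
    rw [hN, e1 v h1 h2 h3]⟩

theorem exists_slide_of_adj {M N : OddMatching G} (h : (flipGraph G).Adj M N) :
    ∃ w, Slide M N w := by
  obtain ⟨e, he, f, hf, hfM, ⟨v, hv, hvf⟩, hN⟩ := h
  obtain ⟨w, rfl⟩ := Sym2.mem_iff_exists.mp hvf
  rw [notMem_verts_iff] at hv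
  subst hv
  have hadj : G.Adj (hole M) w := hf
  have hNadj : ∀ a b, N.1.Adj a b ↔ s(a, b) = s(hole M, w) ∨ (M.1.Adj a b ∧ s(a, b) ≠ e) := by
    intro a b
    rw [← SimpleGraph.Subgraph.mem_edgeSet, hN]
    simp
  have h1 : partner N (hole M) = w := ((adj_iff _ _ _).1 ((hNadj _ _).2 (Or.inl rfl))).2
  have h2 : partner N w = hole M := partner_eq_comm.1 h1
  have hpw : partner M w ≠ hole M := fun h1 =>
    hadj.ne' (by rw [← partner_partner M w, h1, partner_hole])
  have hex : s(w, partner M w) = e := by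
    by_contra hne
    have h3 : N.1.Adj w (partner M w) :=
      (hNadj _ _).2 (Or.inr ⟨(adj_iff _ _ _).2 ⟨hadj.ne', rfl⟩, hne⟩)
    exact hpw (((adj_iff _ _ _).1 h3).2.symm.trans h2)
  subst hex
  have h3 : ∀ v, v ≠ hole M → v ≠ w → v ≠ partner M w → partner N v = partner M v := by
    intro v hv1 hv2 hv3
    have : N.1.Adj v (partner M v) :=
      (hNadj _ _).2 (Or.inr ⟨(adj_iff _ _ _).2 ⟨hv1, rfl⟩, by simp [hv2, hv3]⟩)
    exact ((adj_iff _ _ _).1 this).2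
  refine ⟨w, hadj, ?_, h1, h3⟩
  by_contra hne
  have h4 := (adj_iff N (partner M w) _).2 ⟨fun h => hne h.symm, rfl⟩
  rcases (hNadj _ _).1 h4 with h5 | ⟨h5, h6⟩
  · rcases Sym2.eq_iff.mp h5 with ⟨h, -⟩ | ⟨h, -⟩
    · exact hpw h
    · exact hadj.ne' (partner_eq_self.1 h)
  · rw [adj_iff] at h5
    rw [← h5.2, partner_partner] at h6
    exact h6 Sym2.eq_swap

/-! ### Moving the hole by following a matching -/

/-- Sliding the hole of `K` towards its partner in `M` strictly increases the agreement with `M`. -/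
theorem Slide.disagreement_ssubset {K K₁ M : OddMatching G} (h : Slide K K₁ (partner M (hole K)))
    (C : Set V) (hC : hole K ∈ C) :
    {v ∈ C | partner K₁ v ≠ partner M v} ⊂ {v ∈ C | partner K v ≠ partner M v} := by
  have hM : partner M (hole K) ≠ hole K := h.ne_hole
  rw [Set.ssubset_iff_of_subset]
  · exact ⟨hole K, ⟨hC, by rw [partner_hole]; exact hM.symm⟩, fun h1 => h1.2 h.old_hole⟩
  · rintro v ⟨hv, hne⟩
    refine ⟨hv, fun heq => hne ?_⟩
    by_cases h1 : v = hole K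
    · rw [h1]; exact h.old_hole
    by_cases h2 : v = partner M (hole K)
    · rw [h2, partner_partner]; exact h.middle
    by_cases h3 : v = partner K (partner M (hole K))
    · rw [h3, partner_partner] at heq
      exact absurd (h3.trans (partner_injective M heq).symm) h1
    · rw [h.partner_of_ne v h1 h2 h3, heq]

theorem exists_slide_towards {K M : OddMatching G} (h : hole K ≠ hole M) :
    ∃ K₁, Slide K K₁ (partner M (hole K)) :=
  exists_slide K (adj_partner M h)

/-- Following the edges of `M` moves the hole of `K` out of any set that is closed under `M` and
covered by `M`. -/
theorem exists_walk_hole_notMem [Finite V] (M : OddMatching G) (C : Set V)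
    (hC : ∀ v ∈ C, partner M v ∈ C) (hM : hole M ∉ C) (K : OddMatching G) (hK : hole K ∈ C) :
    ∃ (L : OddMatching G) (p : (flipGraph G).Walk K L), p.length ≤ C.ncard ∧ hole L ∉ C ∧
      (∀ v ∈ C, partner L v = partner M v ∨ partner L v = partner K v) ∧
      (∀ v, v ∉ C → v ≠ hole L → partner L v = partner K v) ∧ partner K (hole L) ∈ C := by
  -- The number of flips is bounded by the number of vertices of `C` at which `K` disagrees with
  -- `M`, since every slide towards `M` lowers it.
  suffices H : ∀ (n : ℕ) (K : OddMatching G), hole K ∈ C →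
      {v ∈ C | partner K v ≠ partner M v}.ncard ≤ n →
      ∃ (L : OddMatching G) (p : (flipGraph G).Walk K L), p.length ≤ n ∧ hole L ∉ C ∧
      (∀ v ∈ C, partner L v = partner M v ∨ partner L v = partner K v) ∧
      (∀ v, v ∉ C → v ≠ hole L → partner L v = partner K v) ∧ partner K (hole L) ∈ C from
    H _ K hK (Set.ncard_le_ncard (fun v hv => hv.1) (Set.toFinite _))
  intro n
  induction n with
  | zero =>
    intro K hK hn
    rw [Nat.le_zero, Set.ncard_eq_zero (Set.toFinite _)] at hn
    exfalso
    have : hole K ∈ {v ∈ C | partner K v ≠ partner M v} := by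
      refine ⟨hK, fun h => hM ?_⟩
      rw [partner_hole] at h
      rwa [hole_eq_of_partner h.symm]
    rw [hn] at this
    exact this
  | succ n ih =>
    intro K hK hn
    obtain ⟨K₁, hs⟩ := exists_slide_towards (K := K) (M := M) (fun h => hM (h ▸ hK))
    have hlt := Set.ncard_lt_ncard (hs.disagreement_ssubset C hK) (Set.toFinite _)
    by_cases hy : hole K₁ ∈ C
    · obtain ⟨L, p, hp, h1, h2, h3, h4⟩ := ih K₁ hy (by omega)
      have hof : ∀ v, v ∉ C → partner K₁ v = partner K v := by
        intro v hv
        refine hs.partner_of_ne v ?_ ?_ ?_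
        · rintro rfl; exact hv hK
        · rintro rfl; exact hv (hC _ hK)
        · intro h; exact hv (by rwa [h, ← hs.hole_eq])
      refine ⟨L, .cons hs.flipGraph_adj p, by simpa using hp, h1, ?_, ?_, ?_⟩
      · intro v hv
        rcases h2 v hv with h | h
        · exact Or.inl h
        rw [h]
        by_cases e1 : v = hole K
        · left; rw [e1]; exact hs.old_hole
        by_cases e2 : v = partner M (hole K)
        · left; rw [e2, partner_partner]; exact hs.middle
        by_cases e3 : v = partner K (partner M (hole K))
        · rw [← hs.hole_eq] at e3
          rw [e3, partner_hole] at h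
          exact absurd (hole_eq_of_partner h ▸ hy) h1
        · right; exact hs.partner_of_ne v e1 e2 e3
      · intro v hv hv'
        rw [h3 v hv hv', hof v hv]
      · rwa [← hof _ h1]
    · refine ⟨K₁, .cons hs.flipGraph_adj .nil, by simp, hy, ?_, ?_, ?_⟩
      · intro v hv
        by_cases e1 : v = hole K
        · left; rw [e1]; exact hs.old_hole
        by_cases e2 : v = partner M (hole K)
        · left; rw [e2, partner_partner]; exact hs.middle
        right
        refine hs.partner_of_ne v e1 e2 ?_
        rintro rfl
        exact hy (hs.hole_eq ▸ hv)
      · intro v hv hv'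
        refine hs.partner_of_ne v ?_ ?_ ?_
        · rintro rfl; exact hv hK
        · rintro rfl; exact hv (hC _ hK)
        · rwa [← hs.hole_eq]
      · rw [hs.hole_eq, partner_partner]
        exact hC _ hK

/-! ### A linear tour of all hole positions -/

/-- The vertices that are left uncovered by some odd matching. -/
def holes (G : SimpleGraph V) : Set V := {v | ∃ K : OddMatching G, hole K = v}

/-- From a hole outside `S` there is an `M`-alternating path to a hole in `S`; the list contains
every second vertex of the path. -/
theorem exists_alternating_path [Finite V] (M : OddMatching G) (S : Set V)
    (hM : hole M ∈ S) {a : V} (ha : a ∈ holes G)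
    (haS : a ∉ S) :
    ∃ (l : List V), l.head? = some a ∧ l.Nodup ∧
      (∀ w ∈ l, partner M w ∉ l ∧ w ∉ S ∧ w ∈ holes G) ∧
      l.IsChain (fun b c => G.Adj (partner M b) c) ∧
      ∃ w ∈ l.getLast?, ∃ y ∈ S, y ∈ holes G ∧ G.Adj y (partner M w) := by
  -- The list records the positions of the hole of `K` while it follows `M` until it enters `S`. The
  -- last clause is added for the induction: a slide makes the old hole and its `M`-partner agree
  -- with `M`, so neither recurs on the rest of the list.
  suffices H : ∀ (n : ℕ) (K : OddMatching G), hole K ∉ S →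
      {v ∈ Set.univ | partner K v ≠ partner M v}.ncard ≤ n →
      ∃ (l : List V), l.head? = some (hole K) ∧ l.Nodup ∧
      (∀ w ∈ l, partner M w ∉ l ∧ w ∉ S ∧ w ∈ holes G) ∧
      l.IsChain (fun b c => G.Adj (partner M b) c) ∧
      (∃ w ∈ l.getLast?, ∃ y ∈ S, y ∈ holes G ∧ G.Adj y (partner M w)) ∧
      ∀ w ∈ l, partner K w ≠ partner M w by
    obtain ⟨K, rfl⟩ := ha
    obtain ⟨l, h1, h2, h3, h4, h5, -⟩ := H _ K haS le_rfl
    exact ⟨l, h1, h2, h3, h4, h5⟩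
  intro n
  induction n with
  | zero =>
    intro K hK hn
    rw [Nat.le_zero, Set.ncard_eq_zero (Set.toFinite _)] at hn
    exfalso
    have : hole K ∈ {v ∈ Set.univ | partner K v ≠ partner M v} := by
      refine ⟨trivial, fun h => hK ?_⟩
      rw [partner_hole] at h
      rwa [← hole_eq_of_partner h.symm]
    rw [hn] at this
    exact this
  | succ n ih =>
    intro K hK hn
    have hne : hole K ≠ hole M := fun h => hK (h ▸ hM)
    obtain ⟨K₁, hs⟩ := exists_slide_towards hne
    have hlt := Set.ncard_lt_ncard (hs.disagreement_ssubset Set.univ trivial) (Set.toFinite _)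
    have hpM : partner M (hole K) ≠ hole K := hs.ne_hole
    have hKK : partner K (hole K) ≠ partner M (hole K) := by
      rw [partner_hole]; exact hpM.symm
    have hadj : G.Adj (partner M (hole K)) (hole K₁) := by
      rw [hs.hole_eq]
      exact adj_partner K hs.ne_hole
    by_cases hy : hole K₁ ∈ S
    · refine ⟨[hole K], rfl, by simp, ?_, by simp, ⟨hole K, rfl, hole K₁, hy, ⟨_, rfl⟩, hadj.symm⟩, ?_⟩
      · simp only [List.mem_singleton, forall_eq]
        exact ⟨hpM, hK, ⟨K, rfl⟩⟩
      · simpa using hKK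
    · obtain ⟨l, h1, h2, h3, h4, ⟨w, hw, h5⟩, h6⟩ := ih K₁ hy (by omega)
      have hl1 : hole K ∉ l := fun h => h6 _ h hs.old_hole
      have hl2 : partner M (hole K) ∉ l := fun h => h6 _ h (by rw [partner_partner]; exact hs.middle)
      refine ⟨hole K :: l, rfl, ?_, ?_, ?_, ⟨w, ?_, h5⟩, ?_⟩
      · exact List.nodup_cons.2 ⟨hl1, h2⟩
      · intro v hv
        rcases List.mem_cons.1 hv with rfl | hv
        · exact ⟨by simp [hpM, hl2], hK, ⟨K, rfl⟩⟩
        · refine ⟨?_, (h3 v hv).2⟩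
          rw [List.mem_cons, not_or]
          refine ⟨fun h => hl2 ?_, (h3 v hv).1⟩
          rwa [← h, partner_partner]
      · rw [List.isChain_cons]
        refine ⟨?_, h4⟩
        intro y hy'
        rw [h1] at hy'
        cases hy'
        exact hadj
      · cases l with
        | nil => simp at h1
        | cons b t => simpa [List.getLast?_cons_cons] using hw
      · intro v hv
        rcases List.mem_cons.1 hv with rfl | hv
        · exact hKK
        · have e1 : v ≠ hole K := by rintro rfl; exact hl1 hv
          have e2 : v ≠ partner M (hole K) := by rintro rfl; exact hl2 hv
          by_cases e3 : v = partner K (partner M (hole K))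
          · rw [e3, partner_partner, ← e3]
            exact fun h => e1 (partner_injective M h).symm
          · rw [← hs.partner_of_ne v e1 e2 e3]
            exact h6 v hv

/-- The hole of `N` can move along an alternating path and back, visiting the partners of the
vertices of `l`. -/
theorem exists_detour (M : OddMatching G) (S : Set V) (l : List V) (hl : l.Nodup)
    (hlS : ∀ w ∈ l, partner M w ∉ l ∧ w ∈ S ∧ partner M w ∈ S)
    (hc : l.IsChain (fun b c => G.Adj (partner M b) c)) (N : OddMatching G) (hx : hole N ∈ S)
    (hxl : ∀ w ∈ l, hole N ≠ partner M w)
    (hhead : ∀ w ∈ l.head?, G.Adj (hole N) w) (hNl : ∀ w ∈ l, partner N w = partner M w)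
    (hN : ∀ v, v ∉ S → partner N v = partner M v) :
    ∃ q : (flipGraph G).Walk N N, q.length = 2 * l.length ∧
      ∀ w ∈ l, ∃ L ∈ q.support, hole L = partner M w ∧ ∀ v, v ∉ S → partner L v = partner M v := by
  induction l generalizing N with
  | nil => exact ⟨.nil, rfl, by simp⟩
  | cons b t ih =>
    obtain ⟨N₁, hs⟩ := exists_slide N (hhead b rfl)
    have hb := hlS b (by simp)
    have hNb : partner N b = partner M b := hNl b (by simp)
    have hN₁h : hole N₁ = partner M b := hs.hole_eq.trans hNb
    have hbt : b ∉ t := (List.nodup_cons.1 hl).1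
    have hmem : ∀ w ∈ t, w ∈ b :: t := fun w hw => List.mem_cons_of_mem b hw
    have hN₁ : ∀ v, v ∉ S → partner N₁ v = partner M v := by
      intro v hv
      rw [hs.partner_of_ne v, hN v hv]
      · rintro rfl; exact hv hx
      · rintro rfl; exact hv hb.2.1
      · rintro rfl; exact hv (hNb ▸ hb.2.2)
    rw [List.isChain_cons] at hc
    obtain ⟨q, hq, hq'⟩ := ih (List.nodup_cons.1 hl).2
      (fun w hw => ⟨fun h => (hlS w (hmem w hw)).1 (hmem _ h), (hlS w (hmem w hw)).2⟩) hc.2 N₁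
      (hN₁h ▸ hb.2.2)
      (fun w hw h => hbt (by rw [hN₁h] at h; rwa [partner_injective M h]))
      (fun w hw => hN₁h ▸ hc.1 w hw)
      (fun w hw => by
        rw [hs.partner_of_ne w, hNl w (hmem w hw)]
        · rintro rfl
          have h1 := hNl _ (hmem _ hw)
          rw [partner_hole] at h1
          exact hxl _ (hmem _ hw) h1
        · rintro rfl; exact hbt hw
        · rintro rfl; exact hb.1 (hmem _ (hNb ▸ hw))) hN₁
    -- Slide over `b`, make the detour along the rest of the path, and undo the slide: two flips for
    -- each vertex of the list.
    refine ⟨.cons hs.flipGraph_adj (q.append (.cons hs.flipGraph_adj.symm .nil)), ?_, ?_⟩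
    · simp [hq]; ring
    · intro w hw
      rcases List.mem_cons.1 hw with rfl | hw
      · exact ⟨N₁, by simp, hN₁h, hN₁⟩
      · obtain ⟨L, hL, hL'⟩ := hq' w hw
        exact ⟨L, by simp [SimpleGraph.Walk.mem_support_append_iff, hL], hL'⟩

/-- A closed walk can be inserted into another one at any vertex. -/
theorem exists_insert_closed_walk {W : Type*} {H : SimpleGraph W} {a b : W} (p : H.Walk a a)
    (hb : b ∈ p.support) (q : H.Walk b b) :
    ∃ r : H.Walk a a, r.length = p.length + q.length ∧
      (∀ c ∈ p.support, c ∈ r.support) ∧ ∀ c ∈ q.support, c ∈ r.support := by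
  classical
  have hp := p.take_spec hb
  refine ⟨((p.takeUntil b hb).append q).append (p.dropUntil b hb), ?_, ?_, ?_⟩
  · have := congrArg SimpleGraph.Walk.length hp
    simp only [SimpleGraph.Walk.length_append] at this ⊢
    omega
  · intro c hc
    rw [← hp] at hc
    simp only [SimpleGraph.Walk.mem_support_append_iff] at hc ⊢
    tauto
  · intro c hc
    simp only [SimpleGraph.Walk.mem_support_append_iff]
    tauto

/-- There is a closed flip sequence from `M`, of length at most `2 |S|`, that moves the hole to
every possible position in `S` while the matching outside of `S` is undisturbed. -/
structure HasTour (M : OddMatching G) (S : Set V) : Prop where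
  partner_mem : ∀ v ∈ S, partner M v ∈ S
  hole_mem : hole M ∈ S
  exists_walk : ∃ p : (flipGraph G).Walk M M, p.length ≤ 2 * S.ncard ∧
    ∀ x ∈ S, x ∈ holes G →
      ∃ N ∈ p.support, hole N = x ∧ ∀ v, v ∉ S → partner N v = partner M v

theorem HasTour.partner_notMem {M : OddMatching G} {S : Set V} (h : HasTour M S) {v : V}
    (hv : v ∉ S) : partner M v ∉ S := fun h1 => hv (partner_partner M v ▸ h.partner_mem _ h1)

/-- `S` together with the vertices of `l` and their partners in `M`. -/
def addPath (M : OddMatching G) (S : Set V) (l : List V) : Set V :=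
  S ∪ ({v | v ∈ l} ∪ partner M '' {v | v ∈ l})

theorem subset_addPath (M : OddMatching G) (S : Set V) (l : List V) : S ⊆ addPath M S l :=
  Set.subset_union_left

theorem ncard_addPath [Finite V] {M : OddMatching G} {S : Set V} (hS : ∀ v ∈ S, partner M v ∈ S)
    {l : List V} (hl : l.Nodup) (hlS : ∀ w ∈ l, partner M w ∉ l ∧ w ∉ S) :
    (addPath M S l).ncard = S.ncard + 2 * l.length := by
  classical
  have h1 : {v | v ∈ l}.ncard = l.length := by
    rw [← List.toFinset_card_of_nodup hl, ← Set.ncard_coe_finset]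
    congr 1
    ext v
    simp
  rw [addPath, Set.ncard_union_eq ?_ (Set.toFinite _) (Set.toFinite _),
    Set.ncard_union_eq ?_ (Set.toFinite _) (Set.toFinite _),
    Set.ncard_image_of_injective _ (partner_injective M), h1]
  · ring
  · rw [Set.disjoint_left]
    rintro _ hv ⟨w, hw, rfl⟩
    exact (hlS w hw).1 hv
  · rw [Set.disjoint_left]
    rintro v hv (h | ⟨w, hw, rfl⟩)
    · exact (hlS v h).2 hv
    · exact (hlS w hw).2 (partner_partner M w ▸ hS _ hv)

theorem partner_mem_addPath {M : OddMatching G} {S : Set V} (hS : ∀ v ∈ S, partner M v ∈ S)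
    {l : List V} : ∀ v ∈ addPath M S l, partner M v ∈ addPath M S l := by
  rintro v (h | h | ⟨w, hw, rfl⟩)
  · exact Or.inl (hS v h)
  · exact Or.inr (Or.inr ⟨v, h, rfl⟩)
  · rw [partner_partner]
    exact Or.inr (Or.inl hw)

theorem mem_addPath {M : OddMatching G} {S : Set V} {l : List V} {v : V} :
    v ∈ addPath M S l ↔ v ∈ S ∨ v ∈ l ∨ partner M v ∈ l := by
  refine or_congr Iff.rfl (or_congr Iff.rfl ⟨?_, fun h => ⟨_, h, partner_partner M v⟩⟩)
  rintro ⟨w, hw, rfl⟩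
  rwa [partner_partner]

/-- The detour of the hole along an alternating path outside of the territory of a tour. -/
theorem HasTour.exists_detour {M : OddMatching G} {S : Set V} (h : HasTour M S) {l : List V}
    (hl : l.Nodup) (hlS : ∀ w ∈ l, partner M w ∉ l ∧ w ∉ S)
    (hc : l.IsChain (fun b c => G.Adj (partner M b) c)) {N : OddMatching G} (hx : hole N ∈ S)
    (hhead : ∀ w ∈ l.head?, G.Adj (hole N) w)
    (hN : ∀ v, v ∉ S → partner N v = partner M v) :
    ∃ q : (flipGraph G).Walk N N, q.length = 2 * l.length ∧
      ∀ w ∈ l, ∃ L ∈ q.support, hole L = partner M w ∧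
        ∀ v, v ∉ addPath M S l → partner L v = partner M v := by
  refine OddMatchings.exists_detour M (addPath M S l) l hl ?_ hc N (Or.inl hx) ?_ hhead ?_ ?_
  · intro w hw
    refine ⟨(hlS w hw).1, mem_addPath.2 (Or.inr (Or.inl hw)), mem_addPath.2 (Or.inr (Or.inr ?_))⟩
    rwa [partner_partner]
  · intro w hw h1
    exact h.partner_notMem (hlS w hw).2 (h1 ▸ hx)
  · exact fun w hw => hN w (hlS w hw).2
  · exact fun v hv => hN v fun h1 => hv (Or.inl h1)

/-- An alternating path from `x` to `S` ends with an `M`-edge outside `S` whose near end, `partner M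
w`, is adjacent to a hole position `y` in `S`. Either this edge starts an ear that returns to `S`,
or it can be added by itself as a pendant edge. -/
theorem HasTour.exists_ssuperset [Finite V] {M : OddMatching G} {S : Set V} (h : HasTour M S)
    {x : V} (hx : x ∈ holes G) (hxS : x ∉ S) : ∃ T, S ⊂ T ∧ HasTour M T := by
  obtain ⟨l₀, -, -, hl₀, -, w, hw, y, hyS, hy, hyw⟩ :=
    exists_alternating_path M S h.hole_mem hx hxS
  obtain ⟨-, hwS, hwD⟩ := hl₀ w (List.mem_of_mem_getLast? hw)
  have haS := h.partner_notMem hwS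
  obtain ⟨p, hp, hpS⟩ := h.exists_walk
  obtain ⟨N, hNp, rfl, hN⟩ := hpS y hyS hy
  -- If the near end is a hole position, an alternating path leads from it back to `S` and closes an
  -- ear. A detour from `y` visits the partners of the vertices of `l`. The reversed path, entered
  -- from `y'`, visits the vertices of `l` themselves.
  by_cases ha : partner M w ∈ holes G
  · obtain ⟨l, hhead, hnd, hlS, hc, w', hw', y', hyS', hy', hyw'⟩ :=
      exists_alternating_path M S h.hole_mem ha haS
    have hal : partner M w ∈ l := List.mem_of_mem_head? hhead
    obtain ⟨N', hNp', rfl, hN'⟩ := hpS y' hyS' hy'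
    obtain ⟨q, hq, hqv⟩ := h.exists_detour hnd (fun v hv => ⟨(hlS v hv).1, (hlS v hv).2.1⟩) hc hyS
      (by rw [hhead]; rintro v ⟨⟩; exact hyw) hN
    have hrmem : ∀ v, v ∈ (l.map (partner M)).reverse ↔ partner M v ∈ l := by
      intro v
      simp only [List.mem_reverse, List.mem_map]
      constructor
      · rintro ⟨b, hb, rfl⟩
        rwa [partner_partner]
      · exact fun hv => ⟨_, hv, partner_partner M v⟩
    obtain ⟨q', hq', hqv'⟩ := h.exists_detour (l := (l.map (partner M)).reverse)
      (List.nodup_reverse.2 (hnd.map (partner_injective M)))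
      (fun v hv => by
        rw [hrmem] at hv ⊢
        refine ⟨?_, fun h1 => (hlS _ hv).2.1 (h.partner_mem _ h1)⟩
        exact (hlS _ hv).1)
      (by
        rw [List.isChain_reverse, List.isChain_map]
        refine hc.imp fun b c hbc => ?_
        simpa [partner_partner] using hbc.symm)
      hyS' (by
        intro v hv
        rw [List.head?_reverse, List.getLast?_map, Option.mem_def, Option.map_eq_some_iff] at hv
        obtain ⟨b, hb, rfl⟩ := hv
        rw [Option.mem_def, hb] at hw'
        cases hw'
        exact hyw') hN'
    obtain ⟨r, hr, hr1, hr2⟩ := exists_insert_closed_walk p hNp q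
    obtain ⟨r', hr', hr1', hr2'⟩ := exists_insert_closed_walk r (hr1 _ hNp') q'
    refine ⟨addPath M S l, ?_, partner_mem_addPath h.partner_mem, Or.inl h.hole_mem, r', ?_, ?_⟩
    · rw [Set.ssubset_iff_of_subset (subset_addPath M S _)]
      exact ⟨_, mem_addPath.2 (Or.inr (Or.inl hal)), haS⟩
    -- The two detours have `2 * l.length` flips each, which is two for each of the `2 * l.length`
    -- new vertices.
    · rw [ncard_addPath h.partner_mem hnd (fun v hv => ⟨(hlS v hv).1, (hlS v hv).2.1⟩)]
      simp only [List.length_reverse, List.length_map] at hq'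
      omega
    · intro v hv hvD
      rcases mem_addPath.1 hv with h1 | h1 | h1
      · obtain ⟨L, hL, hL1, hL2⟩ := hpS v h1 hvD
        exact ⟨L, hr1' _ (hr1 _ hL), hL1, fun z hz => hL2 z fun hz' => hz (Or.inl hz')⟩
      · obtain ⟨L, hL, hL1, hL2⟩ := hqv' (partner M v) ((hrmem _).2 (by rwa [partner_partner]))
        refine ⟨L, hr2' _ hL, by rw [hL1, partner_partner], fun z hz => hL2 z fun hz' => hz ?_⟩
        simp only [mem_addPath, hrmem, partner_partner] at hz' ⊢
        tauto
      · obtain ⟨L, hL, hL1, hL2⟩ := hqv _ h1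
        exact ⟨L, hr1' _ (hr2 _ hL), by rw [hL1, partner_partner], hL2⟩
  -- The near end is never a hole, so only `w` has to be visited: a detour of two flips for two new
  -- vertices.
  · have hlS : ∀ v ∈ [partner M w], partner M v ∉ [partner M w] ∧ v ∉ S := by
      simp only [List.mem_singleton, forall_eq, partner_partner]
      refine ⟨fun h1 => hwS ?_, haS⟩
      rw [partner_eq_self.1 h1.symm]
      exact h.hole_mem
    obtain ⟨q, hq, hqv⟩ := h.exists_detour (List.nodup_singleton (partner M w)) hlS (by simp) hyS
      (by rintro v ⟨⟩; exact hyw) hN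
    obtain ⟨r, hr, hr1, hr2⟩ := exists_insert_closed_walk p hNp q
    refine ⟨addPath M S [partner M w], ?_, partner_mem_addPath h.partner_mem, Or.inl h.hole_mem,
      r, ?_, ?_⟩
    · rw [Set.ssubset_iff_of_subset (subset_addPath M S _)]
      exact ⟨partner M w, mem_addPath.2 (Or.inr (Or.inl (by simp))), haS⟩
    · rw [ncard_addPath h.partner_mem (List.nodup_singleton _) hlS]
      omega
    · intro v hv hvD
      rcases mem_addPath.1 hv with h1 | h1 | h1
      · obtain ⟨L, hL, hL1, hL2⟩ := hpS v h1 hvD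
        exact ⟨L, hr1 _ hL, hL1, fun z hz => hL2 z fun hz' => hz (Or.inl hz')⟩
      · rw [List.mem_singleton] at h1
        exact absurd (h1 ▸ hvD) ha
      · obtain ⟨L, hL, hL1, hL2⟩ := hqv _ h1
        exact ⟨L, hr2 _ hL, by rw [hL1, partner_partner], hL2⟩

/-- A linear closed flip sequence moves the hole to every possible position. -/
theorem exists_tour [Fintype V] (M : OddMatching G) :
    ∃ p : (flipGraph G).Walk M M, p.length ≤ 2 * Fintype.card V ∧
      ∀ x ∈ holes G, ∃ N ∈ p.support, hole N = x := by
  have h0 : HasTour M {hole M} := by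
    refine ⟨?_, rfl, .nil, by simp, ?_⟩
    · rintro v rfl
      exact partner_hole M
    · rintro v rfl -
      exact ⟨M, by simp, rfl, fun _ _ => rfl⟩
  -- A maximal territory contains every hole position, since otherwise it could be extended.
  obtain ⟨S, hS⟩ := (Set.toFinite {S : Set V | HasTour M S}).exists_maximal ⟨_, h0⟩
  obtain ⟨p, hp, hpS⟩ := hS.prop.exists_walk
  refine ⟨p, hp.trans ?_, fun x hx => ?_⟩
  · rw [← Nat.card_eq_fintype_card]
    exact Nat.mul_le_mul_left 2 (Set.ncard_le_card S)
  · by_cases hxS : x ∈ S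
    · obtain ⟨N, hN, hNx, -⟩ := hpS x hxS hx
      exact ⟨N, hN, hNx⟩
    · obtain ⟨T, hST, hT⟩ := hS.prop.exists_ssuperset hx hxS
      exact absurd (hS.le_of_ge hT hST.le) hST.not_ge

/-! ### Exchanging the components of the union of two matchings -/

/-- `U` is a union of components of the union of the matchings `M` and `M'`. -/
def Biclosed (M M' : OddMatching G) (U : Set V) : Prop :=
  ∀ v ∈ U, partner M v ∈ U ∧ partner M' v ∈ U

/-- The component of `w` in the union of the matchings `M` and `M'`. -/
def orbit (M M' : OddMatching G) (w : V) : Set V :=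
  {v | ∀ U, Biclosed M M' U → w ∈ U → v ∈ U}

section Biclosed

variable {M M' : OddMatching G} {U W : Set V} {w : V}

theorem Biclosed.compl (h : Biclosed M M' U) : Biclosed M M' Uᶜ := fun v hv =>
  ⟨fun h1 => hv (partner_partner M v ▸ (h _ h1).1),
    fun h1 => hv (partner_partner M' v ▸ (h _ h1).2)⟩

theorem Biclosed.union (h : Biclosed M M' U) (h' : Biclosed M M' W) : Biclosed M M' (U ∪ W) := by
  rintro v (hv | hv)
  · exact ⟨Or.inl (h v hv).1, Or.inl (h v hv).2⟩
  · exact ⟨Or.inr (h' v hv).1, Or.inr (h' v hv).2⟩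

theorem mem_orbit_self : w ∈ orbit M M' w := fun _ _ h => h

theorem biclosed_orbit : Biclosed M M' (orbit M M' w) := fun _ hv =>
  ⟨fun U hU hw => (hU _ (hv U hU hw)).1, fun U hU hw => (hU _ (hv U hU hw)).2⟩

theorem Biclosed.orbit_subset (h : Biclosed M M' U) (hw : w ∈ U) : orbit M M' w ⊆ U :=
  fun _ hv => hv U h hw

theorem Biclosed.mem_of_mem_orbit (h : Biclosed M M' U) {v : V} (hv : v ∈ orbit M M' w)
    (hvU : v ∈ U) : w ∈ U := by
  by_contra hw
  exact h.compl.orbit_subset hw hv hvU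

theorem eq_hole_of_hole_mem_orbit (hh : hole M = hole M') (h : hole M ∈ orbit M M' w) :
    w = hole M := by
  have : Biclosed M M' {hole M} := by
    rintro v rfl
    exact ⟨partner_hole M, by rw [hh]; exact partner_hole M'⟩
  exact this.mem_of_mem_orbit h rfl

end Biclosed

/-- A hole next to a component of the union of `M` and `M'` can be used to replace `M` by `M'`
on this component. -/
theorem exists_walk_rotate [Finite V] {M M' N : OddMatching G} {w : V}
    (hM' : hole M' ∉ orbit M M' w) (hN : hole N ∉ orbit M M' w) (hadj : G.Adj (hole N) w)
    (hNM : ∀ v ∈ orbit M M' w, partner N v = partner M v) :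
    ∃ (L : OddMatching G) (p : (flipGraph G).Walk N L), p.length ≤ 2 * (orbit M M' w).ncard ∧
      (∀ v ∈ orbit M M' w, partner L v = partner M' v) ∧
      ∀ v, v ∉ orbit M M' w → partner L v = partner N v := by
  have hCb : Biclosed M M' (orbit M M' w) := biclosed_orbit
  have hw : w ∈ orbit M M' w := mem_orbit_self
  generalize hCdef : orbit M M' w = C at *
  have hCmin : ∀ U, Biclosed M M' U → w ∈ U → C ⊆ U := fun U hU h => hCdef ▸ hU.orbit_subset h
  obtain ⟨K, hs⟩ := exists_slide N hadj
  have hNC : ∀ v ∈ C, partner N v ∈ C := fun v hv => hNM v hv ▸ (hCb v hv).1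
  obtain ⟨L, p, hp, hL, h1, h2, h3⟩ := exists_walk_hole_notMem M' C (fun v hv => (hCb v hv).2)
    hM' K (hs.hole_eq ▸ hNC w hw)
  -- The hole leaves `C` at a vertex that `K` matches into `C`. As `N` maps `C` to itself, the only
  -- such vertex outside `C` is the old hole, which the first slide matched to `w`.
  have hz : hole L = hole N := by
    by_contra hne
    rw [hs.partner_of_ne _ hne] at h3
    · exact hL (partner_partner N (hole L) ▸ hNC _ h3)
    · intro h; exact hL (h ▸ hw)
    · intro h; exact hL (h ▸ hNC w hw)
  refine ⟨L, .cons hs.flipGraph_adj p, ?_, ?_, ?_⟩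
  -- One slide into `C` and at most `C.ncard` slides inside; the factor 2 absorbs the extra one
  -- because `C` is nonempty.
  · have : 0 < C.ncard := (Set.ncard_pos (Set.toFinite _)).2 ⟨w, hw⟩
    simp only [SimpleGraph.Walk.length_cons]
    omega
  · have hwE : partner L w = partner M' w := by
      rcases h1 w hw with h | h
      · exact h
      · rw [hs.middle, ← hz, partner_eq_comm, partner_hole] at h
        exact absurd (h ▸ hw) hL
    have hE : ∀ v ∈ C, partner L v ≠ partner M' v → partner L v = partner M v := by
      intro v hv hne
      have h4 := (h1 v hv).resolve_left hne
      rw [h4, hs.partner_of_ne v, hNM v hv]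
      · rintro rfl; exact hN hv
      · rintro rfl; exact hne hwE
      · rintro rfl
        rw [hs.new_hole] at h4
        exact hL (hole_eq_of_partner h4 ▸ hv)
    -- The vertices not yet switched to `M'` form a union of components that misses `w`. Since `C`
    -- is a single component containing `w`, there are none.
    have hbi : Biclosed M M' {v ∈ C | partner L v ≠ partner M' v} := by
      rintro v ⟨hv, hne⟩
      have h4 := hE v hv hne
      refine ⟨⟨(hCb v hv).1, fun h => hne ?_⟩, (hCb v hv).2, fun h => hne ?_⟩
      · rw [← h4, partner_partner] at h
        exact (partner_eq_comm.1 h.symm).symm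
      · rw [partner_partner] at h
        exact partner_eq_comm.1 h
    intro v hv
    by_contra hne
    exact hCmin _ hbi.compl (fun h => h.2 hwE) hv ⟨hv, hne⟩
  · intro v hv
    by_cases hvz : v = hole N
    · rw [hvz, partner_hole, ← hz, partner_hole]
    · rw [h2 v hv (hz ▸ hvz), hs.partner_of_ne v hvz]
      · rintro rfl; exact hv hw
      · rintro rfl; exact hv (hNC w hw)

/-- A flip sequence ending in `M` can be modified so that it ends in a matching that agrees with
`M'` on all components of the union of `M` and `M'` that were disturbed on the way. -/
theorem exists_walk_exchange [Finite V] {M M' N : OddMatching G} (hh : hole M = hole M')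
    (p : (flipGraph G).Walk N M) (U : Set V) (hU : Biclosed M M' U) (hMU : hole M ∉ U)
    (hpU : ∀ L ∈ p.support, ∀ v ∈ U, partner L v = partner M v)
    (N' : OddMatching G) (hN'U : ∀ v ∈ U, partner N' v = partner M' v)
    (hN' : ∀ v, v ∉ U → partner N' v = partner N v) :
    ∃ (W : Set V) (L' : OddMatching G) (q : (flipGraph G).Walk N' L'), U ⊆ W ∧ Biclosed M M' W ∧
      (∀ L ∈ p.support, ∀ v, v ≠ hole M → partner L v ≠ partner M v → v ∈ W) ∧
      (∀ v ∈ W, partner L' v = partner M' v) ∧ (∀ v, v ∉ W → partner L' v = partner M v) ∧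
      q.length + 2 * U.ncard ≤ p.length + 2 * W.ncard := by
  induction p generalizing U N' with
  | nil =>
    refine ⟨U, N', .nil, subset_rfl, hU, ?_, hN'U, hN', by simp⟩
    intro L hL v _ hne
    simp only [SimpleGraph.Walk.support_nil, List.mem_singleton] at hL
    exact absurd (by rw [hL]) hne
  | @cons N N₁ M hadj p ih =>
    obtain ⟨w, hs⟩ := exists_slide_of_adj hadj
    have hpU₁ : ∀ L ∈ p.support, ∀ v ∈ U, partner L v = partner M v :=
      fun L hL => hpU L (by simp [hL])
    have hNN₁ : ∀ v ∈ U, partner N v = partner N₁ v := fun v hv => by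
      rw [hpU N (by simp) v hv, hpU₁ N₁ (by simp) v hv]
    have hhU : hole N ∉ U := fun h => hs.ne_hole (by
      rw [← hs.old_hole, ← hNN₁ _ h, partner_hole])
    have hwU : w ∉ U := fun h => hs.partner_ne_hole (by rw [hNN₁ _ h, hs.middle])
    have hzU : partner N w ∉ U := fun h => hs.partner_ne (by
      rw [← hs.new_hole, ← hNN₁ _ h, partner_partner])
    have hhole : hole N' = hole N := hole_eq_of_partner (by rw [hN' _ hhU, partner_hole])
    obtain ⟨N₁', hs'⟩ := exists_slide N' (w := w) (hhole ▸ hs.adj)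
    have hN'w : partner N' w = partner N w := hN' w hwU
    have hN₁'U : ∀ v ∈ U, partner N₁' v = partner M' v := by
      intro v hv
      rw [hs'.partner_of_ne v, hN'U v hv]
      · rw [hhole]; rintro rfl; exact hhU hv
      · rintro rfl; exact hwU hv
      · rw [hN'w]; rintro rfl; exact hzU hv
    have hN₁' : ∀ v, v ∉ U → partner N₁' v = partner N₁ v := by
      intro v hv
      by_cases e1 : v = hole N
      · rw [e1, hs.old_hole, ← hhole, hs'.old_hole]
      by_cases e2 : v = w
      · rw [e2, hs.middle, hs'.middle, hhole]
      by_cases e3 : v = partner N w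
      · rw [e3, hs.new_hole, ← hN'w, hs'.new_hole]
      · rw [hs.partner_of_ne v e1 e2 e3, hs'.partner_of_ne v (hhole ▸ e1) e2 (hN'w ▸ e3), hN' v hv]
    -- A vertex disturbed in `N` but no longer in `N₁` must be `w` or the hole of `N`. In the latter
    -- case the flip restored the `M`-edge to `w`, so both lie in the component of `w`.
    have key : ∀ W : Set V, Biclosed M M' W →
        (∀ L ∈ p.support, ∀ v, v ≠ hole M → partner L v ≠ partner M v → v ∈ W) →
        (w ≠ hole M → w ∈ W) → ∀ L ∈ (SimpleGraph.Walk.cons hadj p).support, ∀ v, v ≠ hole M →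
        partner L v ≠ partner M v → v ∈ W := by
      intro W hW hpW hwW L hL v hv hne
      rw [SimpleGraph.Walk.support_cons, List.mem_cons] at hL
      rcases hL with rfl | hL
      · by_cases h1 : partner N₁ v = partner M v
        · by_cases e1 : v = hole L
          · rw [e1, hs.old_hole] at h1
            have hw : w ≠ hole M := fun h => hv (by
              rw [e1, ← partner_partner M (hole L), ← h1, h, partner_hole])
            rw [e1, ← partner_eq_comm.1 h1.symm]
            exact (hW w (hwW hw)).1
          by_cases e2 : v = w
          · subst e2; exact hwW hv
          by_cases e3 : v = partner L w
          · rw [e3, hs.new_hole, ← e3] at h1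
            exact absurd (partner_eq_self.1 h1.symm) hv
          · rw [hs.partner_of_ne v e1 e2 e3] at h1
            exact absurd h1 hne
        · exact hpW N₁ (by simp) v hv h1
      · exact hpW L hL v hv hne
    -- If the component of `w` agrees with `M` from now on, this flip is the last one to touch it,
    -- and it is rotated right away. Otherwise it is disturbed again later and the induction
    -- hypothesis already puts it into `W`.
    by_cases hC : ∀ L ∈ p.support, ∀ v ∈ orbit M M' w, partner L v = partner M v
    · have hN₁C := hC N₁ (by simp)
      have hu : hole M ∉ orbit M M' w := by
        intro h
        have hw := eq_hole_of_hole_mem_orbit hh h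
        have h1 := hN₁C _ h
        rw [partner_hole] at h1
        exact hs.partner_ne (by rw [← hs.hole_eq, hole_eq_of_partner h1, hw])
      have hz : hole N₁ ∉ orbit M M' w := by
        intro h
        have h1 := hN₁C _ h
        rw [partner_hole] at h1
        exact hu (hole_eq_of_partner h1.symm ▸ h)
      have hdisj : Disjoint U (orbit M M' w) := Set.disjoint_left.2
        fun v hv hv' => hwU (hU.mem_of_mem_orbit hv' hv)
      have hz' : hole N₁' = hole N₁ := by rw [hs'.hole_eq, hs.hole_eq, hN'w]
      -- The new hole is the previous partner of `w`, hence adjacent to `w`, as the rotation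
      -- requires.
      obtain ⟨R, r, hr, hR1, hR2⟩ := exists_walk_rotate (M := M) (M' := M') (N := N₁') (w := w)
        (hh ▸ hu) (hz' ▸ hz) (by rw [hz', hs.hole_eq]; exact (adj_partner N hs.ne_hole).symm)
        (fun v hv => by
          rw [hN₁' v (fun h => Set.disjoint_left.1 hdisj h hv), hN₁C v hv])
      obtain ⟨W, L', q, hUW, hW, hpW, hL'W, hL', hq⟩ := ih hh (U ∪ orbit M M' w)
        (hU.union biclosed_orbit) (by rintro (h | h); exacts [hMU h, hu h])
        (fun L hL v hv => hv.elim (hpU₁ L hL v) (hC L hL v)) R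
        (fun v hv => by
          by_cases h : v ∈ orbit M M' w
          · exact hR1 v h
          · rw [hR2 v h, hN₁'U v (hv.resolve_right h)])
        (fun v hv => by
          rw [Set.mem_union, not_or] at hv
          rw [hR2 v hv.2, hN₁' v hv.1])
      refine ⟨W, L', .cons hs'.flipGraph_adj (r.append q), Set.subset_union_left.trans hUW, hW,
        key W hW hpW (fun _ => hUW (Or.inr mem_orbit_self)), hL'W, hL', ?_⟩
      rw [Set.ncard_union_eq hdisj (Set.toFinite _) (Set.toFinite _)] at hq
      simp only [SimpleGraph.Walk.length_cons, SimpleGraph.Walk.length_append]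
      omega
    · push Not at hC
      obtain ⟨L, hL, v, hv, hne⟩ := hC
      obtain ⟨W, L', q, hUW, hW, hpW, hL'W, hL', hq⟩ :=
        ih hh U hU hMU hpU₁ N₁' hN₁'U hN₁'
      refine ⟨W, L', .cons hs'.flipGraph_adj q, hUW, hW, key W hW hpW ?_, hL'W, hL', ?_⟩
      · intro hw
        refine hW.mem_of_mem_orbit hv (hpW L hL v ?_ hne)
        rintro rfl
        exact hw (eq_hole_of_hole_mem_orbit hh hv)
      · simp only [SimpleGraph.Walk.length_cons]
        omega

/-! ### The linear bound -/

/-- A set closed under `M` is undisturbed as long as the hole does not enter it. -/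
theorem partner_eq_of_hole_notMem {M N L : OddMatching G} {C : Set V}
    (hC : ∀ v ∈ C, partner M v ∈ C) (p : (flipGraph G).Walk N L)
    (hp : ∀ K ∈ p.support, hole K ∉ C) (hN : ∀ v ∈ C, partner N v = partner M v) :
    ∀ v ∈ C, partner L v = partner M v := by
  induction p with
  | nil => exact hN
  | @cons N N₁ L hadj p ih =>
    obtain ⟨w, hs⟩ := exists_slide_of_adj hadj
    have h₁ : hole N₁ ∉ C := hp N₁ (by simp)
    have hh : hole N ∉ C := hp N (by simp)
    refine ih (fun K hK => hp K (by simp [hK])) fun v hv => ?_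
    rw [hs.partner_of_ne v, hN v hv]
    · rintro rfl; exact hh hv
    · rintro rfl
      rw [hs.hole_eq, hN v hv] at h₁
      exact h₁ (hC v hv)
    · rintro rfl
      exact h₁ (hs.hole_eq ▸ hv)

theorem exists_walk_of_hole_eq [Fintype V] {M M' : OddMatching G} (hh : hole M = hole M')
    (h : Reconfigurable M M') : ReconfigurableWithin (4 * Fintype.card V) M M' := by
  obtain ⟨r⟩ := h
  obtain ⟨p, hp, hpD⟩ := exists_tour M
  obtain ⟨W, L', q, -, hW, hpW, hL'W, hL', hq⟩ := exists_walk_exchange hh p ∅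
    (fun _ h => h.elim) (fun h => h) (fun _ _ _ h => h.elim) M (fun _ h => h.elim)
    (fun _ _ => rfl)
  have hL : L' = M' := by
    apply ext_partner
    intro v
    by_cases hv : v ∈ W
    · exact hL'W v hv
    rw [hL' v hv]
    by_contra hne
    -- Only here is the given reconfiguration used: to change the component of `v` its hole must
    -- enter it, and the tour then visits that hole position too.
    have hex : ∃ K ∈ r.support, hole K ∈ orbit M M' v := by
      by_contra hcon
      push Not at hcon
      exact hne (partner_eq_of_hole_notMem (fun a ha => (biclosed_orbit a ha).1) r hcon
        (fun _ _ => rfl) v mem_orbit_self).symm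
    obtain ⟨K, -, hK⟩ := hex
    obtain ⟨N, hN, hNK⟩ := hpD (hole K) ⟨K, rfl⟩
    have hKM : hole K ≠ hole M := by
      intro h1
      rw [h1] at hK
      apply hne
      rw [eq_hole_of_hole_mem_orbit hh hK, partner_hole, hh, partner_hole]
    refine hv (hW.mem_of_mem_orbit hK (hpW N hN _ hKM ?_))
    rw [← hNK, partner_hole, ne_comm, Ne, partner_eq_self, hNK]
    exact hKM
  subst hL
  refine ⟨q, ?_⟩
  have hWc : W.ncard ≤ Fintype.card V := by
    rw [← Nat.card_eq_fintype_card]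
    exact Set.ncard_le_card W
  rw [Set.ncard_empty] at hq
  omega

theorem Reconfigurable.within [Fintype V] {M M' : OddMatching G} (h : Reconfigurable M M') :
    ReconfigurableWithin (5 * Fintype.card V) M M' := by
  by_cases hh : hole M = hole M'
  · obtain ⟨q, hq⟩ := exists_walk_of_hole_eq hh h
    exact ⟨q, by omega⟩
  -- Leaving the complement of the hole of `M'` means arriving at that hole; this costs at most `n`
  -- flips on top of the `4n`.
  · obtain ⟨L, p, hp, hL, -⟩ := exists_walk_hole_notMem M' {hole M'}ᶜ
      (fun v hv h1 => hv (by
        rw [Set.mem_singleton_iff, partner_eq_comm, partner_hole] at h1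
        exact h1.symm)) (by simp) M hh
    obtain ⟨q, hq⟩ := exists_walk_of_hole_eq (by simpa using hL)
      ((SimpleGraph.Walk.reachable p).symm.trans h)
    refine ⟨p.append q, ?_⟩
    have hc : ({hole M'}ᶜ : Set V).ncard ≤ Fintype.card V := by
      rw [← Nat.card_eq_fintype_card]
      exact Set.ncard_le_card _
    rw [SimpleGraph.Walk.length_append]
    omega

/-- The diameter of a component is measured in the component as a graph of its own, so walks have to
be transferred there without changing their length. -/
theorem exists_walk_toSimpleGraph {W : Type*} {H : SimpleGraph W} (K : H.ConnectedComponent)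
    {a b : W} (p : H.Walk a b) (ha : a ∈ K) (hb : b ∈ K) :
    ∃ q : K.toSimpleGraph.Walk ⟨a, ha⟩ ⟨b, hb⟩, q.length = p.length := by
  induction p with
  | nil => exact ⟨.nil, rfl⟩
  | @cons a c b h p ih =>
    have hc : c ∈ K := SimpleGraph.ConnectedComponent.mem_supp_of_adj_mem_supp K ha h
    obtain ⟨q, hq⟩ := ih hc hb
    exact ⟨.cons ((K.toSimpleGraph_adj ha hc).2 h) q, by simp [hq]⟩

end OddMatchings

theorem mainTheorem2 :
    ∃ C : ℕ, ∀ (V : Type*) [Fintype V] (G : SimpleGraph V),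
      (∀ M M' : OddMatchings.OddMatching G, OddMatchings.Reconfigurable M M' →
        OddMatchings.ReconfigurableWithin (C * Fintype.card V) M M') ∧
      (∀ K : (OddMatchings.flipGraph G).ConnectedComponent,
        K.toSimpleGraph.ediam ≤ ((C * Fintype.card V : ℕ) : ℕ∞)) := by
  refine ⟨5, fun V _ G => ⟨fun M M' h => h.within, fun K => ?_⟩⟩
  refine SimpleGraph.ediam_le_of_edist_le ?_
  rintro ⟨M, hM⟩ ⟨M', hM'⟩
  have h : OddMatchings.Reconfigurable M M' := K.reachable_of_mem_supp hM hM'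
  obtain ⟨p, hp⟩ := h.within
  obtain ⟨q, hq⟩ := OddMatchings.exists_walk_toSimpleGraph K p hM hM'
  refine (SimpleGraph.Walk.edist_le q).trans ?_
  exact_mod_cast hq.le.trans hp
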